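/- Let $(F,\partial_1,\dots,\partial_m)$ be a differential field of characteristic zero, i.e. a field $F$ of characteristic zero with $m$ pairwise commuting derivations $\partial_1,\dots,\partial_m$. A $\partial$-differential polynomial over $F$ in indeterminates $y_1,\dots,y_l$ is a polynomial over $F$ in the algebraically independent symbols $\partial_1^{\alpha_1}\cdots\partial_m^{\alpha_m}y_i$ ($1\le i\le l$, $\alpha\in\mathbb{Z}_{\ge 0}^m$). Put $$GL^{\partial}(m,F)=\{g=(g_{ij})\in GL(m,F):\ \partial_i g_{jk}=\partial_j g_{ik}\ \text{for } i,j,k=1,\dots,m\}.$$ Let $T=(t_{ij})_{i,j=1,\dots,m}$ be the matrix of differential indeterminates over $F$ with the basic relations $\partial_k t_{ij}=\partial_i t_{kj}$ for $i,j,k=1,\dots,m$; that is, $t_{ij}$ is the class of $x_{ij}$ in the quotient of the ring of $\partial$-differential polynomials over $F$ in $m^2$ indeterminates $x_{ij}$ by the differential ideal generated by all $\partial_k x_{ij}-\partial_i x_{kj}$. Then the following three conditions are equivalent. (a) The derivations $\partial_1,\dots,\partial_m$ are linearly independent over $F$ (as operators on $F$). (b) There is no nonzero $\partial$-differential polynomial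 over $F$, in any finite number $l$ of indeterminates, which vanishes at all values of the indeterminates from $F$. (c) Every $\partial$-differential polynomial $p^{\partial}\{(x_{ij})_{i,j=1,\dots,m}\}$ over $F$ such that $p^{\partial}\{g\}=0$ for all $g\in GL^{\partial}(m,F)$ also satisfies $p^{\partial}\{T\}=0$. -/

import Mathlib

universe u v

open MvPolynomial

/-- The (absolute, that is `ℤ`-linear) derivations of a commutative ring `R`: the additive maps
`d : R → R` with `d (a b) = a d b + b d a`. -/
abbrev RingDerivation (R : Type u) [CommRing R] : Type u :=
  Derivation ℤ R R

/-- A system `∂₁, …, ∂ₘ` of pairwise commuting derivations on a commutative ring `R`. A field with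
such a system is a (partial) differential field. -/
structure CommutingDerivations (m : ℕ) (R : Type u) [CommRing R] where
  /-- the derivations -/
  d : Fin m → RingDerivation R
  comm : ∀ i j a, d i (d j a) = d j (d i a)

namespace CommutingDerivations

variable {m : ℕ} {R : Type u} [CommRing R]

theorem commute (Δ : CommutingDerivations m R) (i j : Fin m) :
    Commute (Δ.d i : Module.End ℤ R) (Δ.d j : Module.End ℤ R) := by
  rw [commute_iff_eq]
  ext a
  exact Δ.comm i j a

theorem pairwise_commute (Δ : CommutingDerivations m R) (α : Fin m →₀ ℕ) :
    ((Finset.univ : Finset (Fin m)) : Set (Fin m)).Pairwise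
      (Function.onFun Commute fun i => (Δ.d i : Module.End ℤ R) ^ α i) :=
  fun i _ j _ _ => (Δ.commute i j).pow_pow (α i) (α j)

/-- The operator `∂^α = ∂₁^{α₁} ⋯ ∂ₘ^{αₘ}` of a multi-index `α`. -/
noncomputable def iter (Δ : CommutingDerivations m R) (α : Fin m →₀ ℕ) : Module.End ℤ R :=
  Finset.univ.noncommProd (fun i => (Δ.d i : Module.End ℤ R) ^ α i) (Δ.pairwise_commute α)

/-- The ideal `I` is closed under all the derivations. -/
def IsDiffIdeal (Δ : CommutingDerivations m R) (I : Ideal R) : Prop :=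
  ∀ k, ∀ x ∈ I, Δ.d k x ∈ I

/-- The differential ideal generated by a set: the smallest ideal that contains the set and is
closed under all the derivations. -/
def diffSpan (Δ : CommutingDerivations m R) (S : Set R) : Ideal R :=
  sInf {I : Ideal R | S ⊆ I ∧ Δ.IsDiffIdeal I}

theorem isDiffIdeal_diffSpan (Δ : CommutingDerivations m R) (S : Set R) :
    Δ.IsDiffIdeal (Δ.diffSpan S) := by
  intro k x hx
  simp only [diffSpan, Submodule.mem_sInf] at hx ⊢
  exact fun I hI => hI.2 k x (hx I hI)

/-- The derivation induced by `∂ₖ` on the quotient by a differential ideal. -/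
noncomputable def quotientDerivation (Δ : CommutingDerivations m R) (I : Ideal R)
    (hI : Δ.IsDiffIdeal I) (k : Fin m) : RingDerivation (R ⧸ I) :=
  Derivation.liftOfSurjective (f := (Ideal.Quotient.mk I).toIntAlgHom) (d := Δ.d k)
    (fun x => Ideal.Quotient.mk_surjective x)
    (fun x hx => Ideal.Quotient.eq_zero_iff_mem.2 (hI k x (Ideal.Quotient.eq_zero_iff_mem.1 hx)))

theorem quotientDerivation_mk (Δ : CommutingDerivations m R) (I : Ideal R)
    (hI : Δ.IsDiffIdeal I) (k : Fin m) (x : R) :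
    Δ.quotientDerivation I hI k (Ideal.Quotient.mk I x) = Ideal.Quotient.mk I (Δ.d k x) :=
  Derivation.liftOfSurjective_apply (f := (Ideal.Quotient.mk I).toIntAlgHom) (d := Δ.d k)
    (fun x => Ideal.Quotient.mk_surjective x)
    (fun x hx => Ideal.Quotient.eq_zero_iff_mem.2 (hI k x (Ideal.Quotient.eq_zero_iff_mem.1 hx))) x

/-- The commuting derivations induced on the quotient by a differential ideal. -/
noncomputable def quotient (Δ : CommutingDerivations m R) (I : Ideal R) (hI : Δ.IsDiffIdeal I) :
    CommutingDerivations m (R ⧸ I) where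
  d := Δ.quotientDerivation I hI
  comm i j a := by
    obtain ⟨a, rfl⟩ := Ideal.Quotient.mk_surjective a
    simp only [quotientDerivation_mk, Δ.comm i j]

end CommutingDerivations

/-- The ring `R{y_i : i ∈ ι; ∂}` of `∂`-differential polynomials over `R` in differentially
independent indeterminates `y_i`: polynomials in the variables `∂^α y_i`, where the variable
indexed by `(i, α)` stands for `∂^α y_i`. -/
abbrev DiffPoly (m : ℕ) (ι : Type v) (R : Type u) [CommRing R] : Type (max u v) :=
  MvPolynomial (ι × (Fin m →₀ ℕ)) R

namespace DiffPoly

variable {m : ℕ} {ι : Type v} {R : Type u} [CommRing R]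

/-- The additive map of a polynomial ring that applies the derivation `d` to every coefficient. -/
noncomputable def mapCoeff {σ : Type v} (d : RingDerivation R) :
    MvPolynomial σ R →ₗ[ℤ] MvPolynomial σ R :=
  AddMonoidHom.toIntLinearMap
    { toFun := fun p => AddMonoidAlgebra.map (d : R →ₗ[ℤ] R).toAddMonoidHom p
      map_zero' := by ext s; exact map_zero d
      map_add' := fun p q => by ext s; exact map_add d _ _ }

theorem coeff_mapCoeff {σ : Type v} (d : RingDerivation R) (p : MvPolynomial σ R) (s : σ →₀ ℕ) :
    coeff s (mapCoeff d p) = d (coeff s p) := rfl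

theorem mapCoeff_monomial {σ : Type v} (d : RingDerivation R) (s : σ →₀ ℕ) (a : R) :
    mapCoeff d (monomial s a) = monomial s (d a) := by
  classical
  ext t
  rw [coeff_mapCoeff, coeff_monomial, coeff_monomial]
  split_ifs <;> simp

/-- The derivation of a polynomial ring that extends `d` and kills the variables. -/
noncomputable def coeffDerivation {σ : Type v} (d : RingDerivation R) :
    RingDerivation (MvPolynomial σ R) :=
  Derivation.mk' (mapCoeff d) (by
    intro p q
    induction p using MvPolynomial.induction_on' with
    | add p₁ p₂ h₁ h₂ =>
      simp only [add_mul, map_add, h₁, h₂, smul_eq_mul, mul_add]; ring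
    | monomial s a =>
      induction q using MvPolynomial.induction_on' with
      | add q₁ q₂ h₁ h₂ =>
        simp only [mul_add, map_add, h₁, h₂, smul_eq_mul, add_mul]; ring
      | monomial t b =>
        simp only [monomial_mul, mapCoeff_monomial, smul_eq_mul, Derivation.leibniz, map_add]
        rw [add_comm t s, mul_comm b (d a)])

/-- The derivation of `R{y_i : i ∈ ι; ∂}` that extends the derivation `∂ₖ` of `R` and maps
`∂^α y_i` to `∂ₖ ∂^α y_i`. -/
noncomputable def deriv (Δ : CommutingDerivations m R) (k : Fin m) :
    RingDerivation (DiffPoly m ι R) :=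
  coeffDerivation (Δ.d k) +
    (mkDerivation R fun v : ι × (Fin m →₀ ℕ) =>
      (X (v.1, v.2 + Finsupp.single k 1) : DiffPoly m ι R)).restrictScalars ℤ

theorem deriv_C (Δ : CommutingDerivations m R) (k : Fin m) (a : R) :
    deriv Δ k (C a : DiffPoly m ι R) = C (Δ.d k a) := by
  have h : (coeffDerivation (Δ.d k) : RingDerivation (DiffPoly m ι R)) (C a) = C (Δ.d k a) :=
    mapCoeff_monomial _ _ _
  exact (congrArg₂ (· + ·) h (derivation_C _ a)).trans (add_zero _)

theorem deriv_X (Δ : CommutingDerivations m R) (k : Fin m) (v : ι × (Fin m →₀ ℕ)) :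
    deriv Δ k (X v : DiffPoly m ι R) = X (v.1, v.2 + Finsupp.single k 1) := by
  have h : (coeffDerivation (Δ.d k) : RingDerivation (DiffPoly m ι R)) (X v) = 0 :=
    (mapCoeff_monomial _ _ _).trans (by simp)
  exact (congrArg₂ (· + ·) h (mkDerivation_X R _ v)).trans (zero_add _)

/-- The commuting derivations of the ring of differential polynomials. -/
noncomputable def derivations (Δ : CommutingDerivations m R) :
    CommutingDerivations m (DiffPoly m ι R) where
  d := deriv Δ
  comm i j p := by
    induction p using MvPolynomial.induction_on with
    | C a => rw [deriv_C, deriv_C, deriv_C, deriv_C, Δ.comm]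
    | add p q hp hq => rw [map_add, map_add, map_add, map_add, hp, hq]
    | mul_X p v hp =>
      have h (i j : Fin m) : deriv Δ i (deriv Δ j (p * X v)) =
          p * X (v.1, v.2 + Finsupp.single j 1 + Finsupp.single i 1)
            + X (v.1, v.2 + Finsupp.single j 1) * deriv Δ i p
            + (X v * deriv Δ i (deriv Δ j p)
              + deriv Δ j p * X (v.1, v.2 + Finsupp.single i 1)) := by
        rw [Derivation.leibniz, map_add, deriv_X, smul_eq_mul, smul_eq_mul, Derivation.leibniz,
          Derivation.leibniz, deriv_X, deriv_X, smul_eq_mul, smul_eq_mul, smul_eq_mul, smul_eq_mul]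
      rw [h, h, hp, add_right_comm v.2]
      ring

/-- The value `p^∂{a}` of a differential polynomial `p` over `F` at a family `a` of elements of an
`F`-algebra `S` with derivations `Δ`: the variable `∂^α y_i` is replaced by `∂^α a_i`. -/
noncomputable def eval {F : Type u} [CommRing F] {S : Type*} [CommRing S] [Algebra F S]
    (Δ : CommutingDerivations m S) (a : ι → S) (p : DiffPoly m ι F) : S :=
  aeval (fun v : ι × (Fin m →₀ ℕ) => Δ.iter v.2 (a v.1)) p

end DiffPoly

section Generic

variable {m : ℕ} {F : Type u} [Field F]

/-- The set `GL^∂(m, F)` of the invertible matrices `g` with `∂ᵢ g_{jk} = ∂ⱼ g_{ik}`. -/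
def GLd (Δ : CommutingDerivations m F) : Set (Matrix.GeneralLinearGroup (Fin m) F) :=
  {g | ∀ i j k, Δ.d i (g.1 j k) = Δ.d j (g.1 i k)}

/-- The differential ideal of `F{x_{ij} : i, j = 1, …, m; ∂}` generated by all
`∂ₖ x_{ij} - ∂ᵢ x_{kj}`. -/
noncomputable def closedIdeal (Δ : CommutingDerivations m F) :
    Ideal (DiffPoly m (Fin m × Fin m) F) :=
  (DiffPoly.derivations Δ).diffSpan
    {r | ∃ i j k : Fin m, r = (DiffPoly.derivations Δ).d k (X ((i, j), 0))
      - (DiffPoly.derivations Δ).d i (X ((k, j), 0))}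

/-- The differential ring `F{T; ∂}` generated over `F` by indeterminates `t_{ij}` subject to the
basic relations `∂ₖ t_{ij} = ∂ᵢ t_{kj}` only. -/
abbrev GenericRing (Δ : CommutingDerivations m F) : Type u :=
  DiffPoly m (Fin m × Fin m) F ⧸ closedIdeal Δ

/-- The derivations of `F{T; ∂}`. -/
noncomputable def genericDerivations (Δ : CommutingDerivations m F) :
    CommutingDerivations m (GenericRing Δ) :=
  (DiffPoly.derivations Δ).quotient (closedIdeal Δ)
    ((DiffPoly.derivations Δ).isDiffIdeal_diffSpan _)

/-- The generic matrix `T = (t_{ij})`. -/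
noncomputable def genericMatrix (Δ : CommutingDerivations m F) :
    Matrix (Fin m) (Fin m) (GenericRing Δ) :=
  Matrix.of fun i j => Ideal.Quotient.mk (closedIdeal Δ) (X ((i, j), 0))

end Generic

/-! (a) ⇒ (b): if `∑ c_α ∂^α = 0`, its commutator with multiplication by `u` is a vanishing operator
of lower order, so by induction its coefficients are zero. The top ones give relations among the
`∂ᵢ`, which kill the top `c_α` in characteristic zero (`eq_zero_of_sum_iter_eq_zero`). Linearly
independent additive maps are algebraically independent (`eq_zero_of_forall_eval_additive_eq_zero`),
which is (b).

(b) ⇒ (c): by `mem_closedIdeal_iff`, `T` is the generic Jacobian matrix `(∂ᵢ y_j)`. If `p` vanishes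
on `GL^∂`, then `p{∂ᵢ y_j} · det (∂ᵢ y_j)` vanishes at all values, hence is zero, and the
determinant is not.

(c) ⇒ (a): a relation `∑ cᵢ ∂ᵢ = 0` makes every `∑ cᵢ ∂ᵢ x_{kk}` vanish identically on `F`, but at
`T` it is zero only if `c_k = 0`. -/

namespace CommutingDerivations

/-! ### The operators `∂^α`: Leibniz rule and linear independence. -/

variable {m : ℕ} {R : Type u} [CommRing R] (Δ : CommutingDerivations m R)

theorem iter_zero : Δ.iter 0 = 1 := by
  unfold iter
  rw [Finset.noncommProd_eq_pow_card _ _ _ 1 (by simp), one_pow]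

theorem iter_add (α β : Fin m →₀ ℕ) : Δ.iter (α + β) = Δ.iter α * Δ.iter β := by
  unfold iter
  rw [← Finset.noncommProd_mul_distrib]
  · exact Finset.noncommProd_congr rfl (fun i _ => pow_add _ _ _) _
  · exact fun i _ j _ _ => (Δ.commute i j).pow_pow _ _

theorem iter_single (k : Fin m) : Δ.iter (Finsupp.single k 1) = (Δ.d k : Module.End ℤ R) := by
  have h : ∀ i ∈ Finset.univ.erase k,
      (Δ.d i : Module.End ℤ R) ^ (Finsupp.single k 1 : Fin m →₀ ℕ) i = 1 := fun i hi => by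
    rw [Finsupp.single_eq_of_ne (Finset.ne_of_mem_erase hi), pow_zero]
  refine (Finset.mul_noncommProd_erase _ (Finset.mem_univ k) _ _).symm.trans ?_
  refine (congrArg₂ _ (by rw [Finsupp.single_eq_same, pow_one])
    ((Finset.noncommProd_eq_pow_card _ _ _ 1 h).trans (one_pow _))).trans (mul_one _)

@[simp]
theorem iter_zero_apply (a : R) : Δ.iter 0 a = a := by
  rw [iter_zero]; rfl

@[simp]
theorem iter_single_apply (k : Fin m) (a : R) : Δ.iter (Finsupp.single k 1) a = Δ.d k a := by
  rw [iter_single]; rfl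

theorem iter_add_single_apply (α : Fin m →₀ ℕ) (k : Fin m) (a : R) :
    Δ.iter (α + Finsupp.single k 1) a = Δ.d k (Δ.iter α a) := by
  rw [add_comm, iter_add, iter_single]; rfl

theorem iter_d_apply (α : Fin m →₀ ℕ) (k : Fin m) (a : R) :
    Δ.iter α (Δ.d k a) = Δ.iter (α + Finsupp.single k 1) a := by
  rw [iter_add, iter_single]; rfl

/-- Induction on multi-indices, raising one entry at a time. -/
theorem multiIndex_induction {motive : (Fin m →₀ ℕ) → Prop} (zero : motive 0)
    (add_single : ∀ α k, motive α → motive (α + Finsupp.single k 1)) (α : Fin m →₀ ℕ) :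
    motive α := by
  suffices h : ∀ β, motive β → motive (β + α) by simpa using h 0 zero
  induction α using Finsupp.induction_linear with
  | zero => exact fun β hβ => by simpa using hβ
  | add α₁ α₂ h₁ h₂ => exact fun β hβ => add_assoc β α₁ α₂ ▸ h₂ _ (h₁ β hβ)
  | single k b =>
    intro β hβ
    induction b with
    | zero => simpa using hβ
    | succ b hb =>
      rw [Finsupp.single_add, ← add_assoc]
      exact add_single _ _ hb

/-- Ring homomorphisms that commute with the derivations commute with the operators `∂^α`. -/
theorem map_iter {S : Type v} [CommRing S] (Δ' : CommutingDerivations m S) (f : R →+* S)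
    (hf : ∀ k a, f (Δ.d k a) = Δ'.d k (f a)) (α : Fin m →₀ ℕ) (a : R) :
    f (Δ.iter α a) = Δ'.iter α (f a) := by
  induction α using multiIndex_induction with
  | zero => simp
  | add_single α k ih => rw [iter_add_single_apply, iter_add_single_apply, hf, ih]

theorem IsDiffIdeal.iter_mem {Δ : CommutingDerivations m R} {I : Ideal R} (hI : Δ.IsDiffIdeal I)
    (α : Fin m →₀ ℕ) {a : R} (ha : a ∈ I) : Δ.iter α a ∈ I := by
  induction α using multiIndex_induction with
  | zero => simpa using ha
  | add_single α k ih => rw [iter_add_single_apply]; exact hI k _ ih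

theorem subset_diffSpan (S : Set R) : S ⊆ Δ.diffSpan S := by
  intro x hx
  simp only [diffSpan, SetLike.mem_coe, Submodule.mem_sInf]
  exact fun I hI => hI.1 hx

theorem diffSpan_le {S : Set R} {I : Ideal R} (hS : S ⊆ I) (hI : Δ.IsDiffIdeal I) :
    Δ.diffSpan S ≤ I :=
  sInf_le ⟨hS, hI⟩

/-- The Leibniz rule for `∂^α`, up to terms of order at most `|α| - 2` in the second factor. -/
theorem exists_iter_mul (u : R) (α : Fin m →₀ ℕ) :
    ∃ r : (Fin m →₀ ℕ) →₀ R, (∀ β, r β ≠ 0 → β.degree + 2 ≤ α.degree) ∧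
      ∀ v, Δ.iter α (u * v) = u * Δ.iter α v
        + ∑ i, α i * Δ.d i u * Δ.iter (α - Finsupp.single i 1) v
        + r.sum fun β c => c * Δ.iter β v := by
  classical
  induction α using multiIndex_induction with
  | zero => exact ⟨0, by simp, by simp⟩
  | add_single α k ih =>
    obtain ⟨r, hr, h⟩ := ih
    -- The remainder of `∂ₖ` applied to the formula: `∂ₖ` hits `∂ᵢ u`, or a coefficient of `r`, or
    -- raises an operator in `r`.
    refine ⟨(∑ i, Finsupp.single (α - Finsupp.single i 1) (α i * Δ.d k (Δ.d i u)))
      + r.mapRange (Δ.d k) (map_zero _)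
      + r.mapDomain (· + Finsupp.single k 1), ?_, ?_⟩
    · intro β hβ
      rw [map_add, Finsupp.degree_single]
      by_contra hlt
      apply hβ
      rw [Finsupp.add_apply, Finsupp.add_apply, Finsupp.finsetSum_apply, Finset.sum_eq_zero,
        zero_add, Finsupp.mapRange_apply]
      · have h1 : r β = 0 := by
          by_contra h0
          have := hr β h0
          omega
        rw [h1, map_zero, zero_add, Finsupp.mapDomain, Finsupp.sum_apply]
        refine Finset.sum_eq_zero fun γ hγ => Finsupp.single_eq_of_ne ?_
        rintro rfl
        have := hr γ (Finsupp.mem_support_iff.1 hγ)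
        rw [map_add, Finsupp.degree_single] at hlt
        omega
      · intro i _
        by_cases hi : α i = 0
        · simp [hi]
        · refine Finsupp.single_eq_of_ne ?_
          rintro rfl
          have hle : Finsupp.single i 1 ≤ α := by
            rw [Finsupp.single_le_iff]; omega
          have := congrArg Finsupp.degree (tsub_add_cancel_of_le hle)
          rw [map_add, Finsupp.degree_single] at this
          omega
    · intro v
      have hsum : ∀ f g : (Fin m →₀ ℕ) →₀ R,
          ((f + g).sum fun β c => c * Δ.iter β v)
            = (f.sum fun β c => c * Δ.iter β v) + g.sum fun β c => c * Δ.iter β v :=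
        fun f g => Finsupp.sum_add_index' (by simp) (by intros; ring)
      have hT : ∀ i, ((α + Finsupp.single k 1 : Fin m →₀ ℕ) i : R) * Δ.d i u
            * Δ.iter (α + Finsupp.single k 1 - Finsupp.single i 1) v
          = α i * Δ.d i u * Δ.d k (Δ.iter (α - Finsupp.single i 1) v)
            + if i = k then Δ.d k u * Δ.iter α v else 0 := by
        intro i
        have hα : (α i : R) * Δ.iter (α + Finsupp.single k 1 - Finsupp.single i 1) v
            = α i * Δ.d k (Δ.iter (α - Finsupp.single i 1) v) := by
          by_cases hi : α i = 0
          · simp [hi]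
          · have hle : Finsupp.single i 1 ≤ α := by
              rw [Finsupp.single_le_iff]; omega
            rw [← iter_add_single_apply, tsub_add_eq_add_tsub hle]
        rw [Finsupp.add_apply, Nat.cast_add, add_mul, add_mul, mul_right_comm, hα]
        split_ifs with hik
        · subst hik
          simp only [Finsupp.single_eq_same, Nat.cast_one, one_mul, add_tsub_cancel_right]
          ring
        · rw [Finsupp.single_eq_of_ne hik]
          simp only [Nat.cast_zero, zero_mul]
          ring
      rw [iter_add_single_apply, h, hsum, hsum, ← Finsupp.sum_finsetSum_index (by simp)
        (by intros; ring), Finset.sum_congr rfl fun i _ => hT i, Finset.sum_add_distrib,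
        Finset.sum_ite_eq', if_pos (Finset.mem_univ k), Finsupp.sum_mapRange_index (by simp),
        Finsupp.sum_mapDomain_index (by simp) (by intros; ring),
        Finset.sum_congr rfl fun i _ => Finsupp.sum_single_index (zero_mul _)]
      simp only [map_add, map_sum, Derivation.leibniz, smul_eq_mul, Finsupp.sum,
        iter_add_single_apply, Finset.sum_add_distrib, Derivation.map_natCast, mul_zero, add_zero]
      simp only [mul_comm, mul_left_comm]
      ring

end CommutingDerivations

/-- If the derivations are linearly independent over the field, then so are all the operators
`∂^α`. -/
theorem CommutingDerivations.eq_zero_of_sum_iter_eq_zero {m : ℕ} {F : Type u} [Field F]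
    [CharZero F] (Δ : CommutingDerivations m F) (hΔ : LinearIndependent F Δ.d)
    (c : (Fin m →₀ ℕ) →₀ F) (hc : ∀ v, (c.sum fun α a => a * Δ.iter α v) = 0) : c = 0 := by
  classical
  suffices H : ∀ n, ∀ c : (Fin m →₀ ℕ) →₀ F, (∀ α, c α ≠ 0 → α.degree < n) →
      (∀ v, (c.sum fun α a => a * Δ.iter α v) = 0) → c = 0 from
    H (c.support.sup Finsupp.degree + 1) c (fun α hα => Nat.lt_succ_of_le
      (Finset.le_sup (f := Finsupp.degree) (Finsupp.mem_support_iff.2 hα))) hc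
  clear c hc
  intro n
  induction n with
  | zero =>
    intro c hn _
    ext α
    by_contra hα
    exact absurd (hn α hα) (Nat.not_lt_zero _)
  | succ n ih =>
    intro c hn hc
    refine ih c (fun δ hδ => ?_) hc
    refine lt_of_le_of_ne (Nat.le_of_lt_succ (hn δ hδ)) fun hδn => hδ ?_
    -- Order zero has no index to lower; the operator is multiplication by `c 0`, which is tested on
    -- `1`.
    by_cases hδ0 : δ = 0
    · subst hδ0
      rw [map_zero] at hδn
      subst hδn
      have h0 : c = Finsupp.single 0 (c 0) := by
        ext α
        by_cases hα : α = 0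
        · rw [hα, Finsupp.single_eq_same]
        · rw [Finsupp.single_eq_of_ne hα]
          by_contra h
          exact hα ((Finsupp.degree_eq_zero_iff α).1 (Nat.lt_one_iff.1 (hn α h)))
      have h1 := hc 1
      rw [h0, Finsupp.sum_single_index (zero_mul _)] at h1
      simpa using h1
    obtain ⟨k, hk⟩ : ∃ k, δ k ≠ 0 := by
      by_contra! h
      exact hδ0 (Finsupp.ext h)
    choose r hr hmul using fun u => Δ.exists_iter_mul u
    -- Coefficients of the commutator of `∑ c_α ∂^α` with multiplication by `u`.
    let b : F → (Fin m →₀ ℕ) →₀ F := fun u => c.sum fun α a =>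
      a • ((∑ i, Finsupp.single (α - Finsupp.single i 1) (α i * Δ.d i u)) + r u α)
    have hdeg : ∀ {α : Fin m →₀ ℕ} {i}, α i ≠ 0 →
        (α - Finsupp.single i 1).degree + 1 = α.degree := by
      intro α i hi
      have hle : Finsupp.single i 1 ≤ α := by
        rw [Finsupp.single_le_iff]; omega
      have := congrArg Finsupp.degree (tsub_add_cancel_of_le hle)
      rwa [map_add, Finsupp.degree_single] at this
    have hb : ∀ u, b u = 0 := by
      intro u
      refine ih (b u) (fun γ hγ => ?_) fun v => ?_
      · by_contra hlt
        refine hγ ?_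
        simp only [b, Finsupp.sum_apply]
        refine Finset.sum_eq_zero fun α hα => ?_
        have hαn := hn α (Finsupp.mem_support_iff.1 hα)
        beta_reduce
        rw [Finsupp.smul_apply, Finsupp.add_apply, Finsupp.finsetSum_apply, Finset.sum_eq_zero,
          zero_add]
        · have : r u α γ = 0 := by
            by_contra h
            have := hr u α γ h
            omega
          rw [this, smul_zero]
        · intro i _
          by_cases hi : α i = 0
          · simp [hi]
          · refine Finsupp.single_eq_of_ne ?_
            rintro rfl
            have := hdeg hi
            omega
      · let E : ((Fin m →₀ ℕ) →₀ F) →ₗ[F] F := Finsupp.linearCombination F fun β => Δ.iter β v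
        have hE : ∀ f, E f = f.sum fun β a => a * Δ.iter β v := fun f =>
          Finsupp.linearCombination_apply _ _
        have h1 : ∀ α, E ((∑ i, Finsupp.single (α - Finsupp.single i 1) (α i * Δ.d i u)) + r u α)
            = Δ.iter α (u * v) - u * Δ.iter α v := by
          intro α
          rw [map_add, map_sum, hE (r u α), hmul]
          simp only [E, Finsupp.linearCombination_single, smul_eq_mul]
          ring
        rw [← hE]
        simp only [b, Finsupp.sum, map_sum, map_smul, h1]
        simp only [smul_eq_mul, mul_sub, Finset.sum_sub_distrib]
        have h2 := hc (u * v)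
        have h3 := hc v
        rw [Finsupp.sum] at h2 h3
        rw [h2, zero_sub, neg_eq_zero]
        simp only [mul_left_comm _ u]
        rw [← Finset.mul_sum, h3, mul_zero]
    -- The coefficient of `∂^(δ - e_k)` in the commutator, as a function of `u`. That order is `n -
    -- 1`, while the terms in `r` have order at most `n - 2`.
    have hlin : ∑ i, (∑ α ∈ c.support,
        if α - Finsupp.single i 1 = δ - Finsupp.single k 1 then c α * α i else 0) • Δ.d i = 0 := by
      ext u
      have h0 := DFunLike.congr_fun (hb u) (δ - Finsupp.single k 1)
      simp only [b, Finsupp.sum, Finsupp.smul_apply, Finsupp.add_apply,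
        Finsupp.finsetSum_apply, Finsupp.zero_apply] at h0
      rw [← Derivation.coeFnAddMonoidHom_apply, map_sum, Finset.sum_apply]
      simp only [Derivation.coeFnAddMonoidHom_apply, Derivation.smul_apply, Derivation.zero_apply,
        smul_eq_mul, Finset.sum_mul]
      rw [Finset.sum_comm]
      refine Eq.trans ?_ h0
      refine Finset.sum_congr rfl fun α hα => ?_
      have hr0 : r u α (δ - Finsupp.single k 1) = 0 := by
        by_contra h
        have h4 := hr u α _ h
        have h5 := hdeg hk
        have h6 := hn α (Finsupp.mem_support_iff.1 hα)
        omega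
      rw [hr0, add_zero, smul_eq_mul, Finset.mul_sum]
      refine Finset.sum_congr rfl fun i _ => ?_
      rw [Finsupp.single_apply]
      split_ifs <;> ring
    have hk0 := Fintype.linearIndependent_iff.1 hΔ _ hlin k
    -- Because of truncated subtraction, another `α` can satisfy the condition only if `α k = 0`,
    -- and then its factor `α k` kills it.
    rw [Finset.sum_eq_single δ] at hk0
    · rw [if_pos rfl] at hk0
      exact (mul_eq_zero.1 hk0).resolve_right (Nat.cast_ne_zero.2 hk)
    · intro α _ hne
      split_ifs with h
      · by_cases hα : α k = 0
        · simp [hα]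
        · refine absurd ?_ hne
          have hle : ∀ {β : Fin m →₀ ℕ}, β k ≠ 0 → Finsupp.single k 1 ≤ β := fun hβ => by
            rw [Finsupp.single_le_iff]; omega
          rw [← tsub_add_cancel_of_le (hle hα), h, tsub_add_cancel_of_le (hle hk)]
      · rfl
    · intro h
      rw [Finsupp.notMem_support_iff.1 h, zero_mul, ite_self]

/-! ### Algebraic independence of additive maps. -/

section AdditiveMaps

variable {F : Type u} [Field F] {A : Type v} (D : A → F →+ F)

/-- Finitely many linearly independent functions on `F` take values that span. -/
theorem exists_sum_mul_eq_of_linearIndependent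
    (hD : ∀ c : A →₀ F, (∀ v, (c.sum fun α a => a * D α v) = 0) → c = 0)
    (S : Finset A) (x : A → F) :
    ∃ w : F →₀ F, ∀ α ∈ S, (w.sum fun u a => a * D α u) = x α := by
  classical
  have hspan : Submodule.span F (Set.range fun (u : F) (α : S) => D α u) = ⊤ := by
    -- A nonzero functional vanishing on a proper span would be a linear relation among the `D α`.
    by_contra hne
    obtain ⟨f, hf, hle⟩ := Submodule.exists_le_ker_of_lt_top _ (lt_top_iff_ne_top.2 hne)
    let b : S →₀ F := Finsupp.equivFunOnFinite.symm fun α => f (Pi.single α 1)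
    have hb : b.mapDomain ((↑) : S → A) = 0 := by
      refine hD _ fun v => ?_
      have hv : f (fun α : S => D α v) = 0 := hle (Submodule.subset_span ⟨v, rfl⟩)
      rw [LinearMap.pi_apply_eq_sum_univ] at hv
      rw [Finsupp.sum_mapDomain_index (by simp) (by intros; ring), Finsupp.sum_fintype _ _ (by simp),
        ← hv]
      refine Finset.sum_congr rfl fun α _ => ?_
      rw [smul_eq_mul, mul_comm]
      refine congrArg (D α v * f ·) (funext fun β => ?_)
      simp [Pi.single_apply, eq_comm]
    have hb0 : b = 0 := Finsupp.mapDomain_injective Subtype.val_injective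
      (hb.trans Finsupp.mapDomain_zero.symm)
    refine hf (LinearMap.pi_ext' fun α => LinearMap.ext_ring ?_)
    exact DFunLike.congr_fun hb0 α
  have hx : (fun α : S => x α) ∈ Submodule.span F (Set.range fun (u : F) (α : S) => D α u) :=
    hspan ▸ Submodule.mem_top
  obtain ⟨w, hw⟩ := Finsupp.mem_span_range_iff_exists_finsupp.1 hx
  refine ⟨w, fun α hα => ?_⟩
  have := congrFun hw ⟨α, hα⟩
  simpa [Finsupp.sum, Finset.sum_apply] using this

/-- In characteristic zero, additive maps `F → F` that are linearly independent over `F` are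
algebraically independent. -/
theorem eq_zero_of_forall_eval_additive_eq_zero [CharZero F] {ι : Type*}
    (hD : ∀ c : A →₀ F, (∀ v, (c.sum fun α a => a * D α v) = 0) → c = 0)
    (p : MvPolynomial (ι × A) F)
    (hp : ∀ a : ι → F, MvPolynomial.eval (fun v => D v.2 (a v.1)) p = 0) : p = 0 := by
  classical
  refine MvPolynomial.funext fun x => ?_
  choose w hw using fun i => exists_sum_mul_eq_of_linearIndependent D hD (p.vars.image Prod.snd)
    fun α => x (i, α)
  -- At integer values of its variables, `q` is `p` evaluated at the elements `∑ y (i, u) • u`.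
  -- Additivity of `D α` permits only integer weights, but the integers are infinite in `F`, so `q =
  -- 0` and arbitrary weights `w` may be substituted.
  let q : MvPolynomial (ι × F) F :=
    aeval (fun v : ι × A => ∑ u ∈ (w v.1).support, X (v.1, u) * C (D v.2 u)) p
  have hq : ∀ y : ι × F → F, MvPolynomial.eval y q =
      MvPolynomial.eval (fun v : ι × A => ∑ u ∈ (w v.1).support, y (v.1, u) * D v.2 u) p := by
    intro y
    simp only [q, aeval_def, algebraMap_eq, MvPolynomial.eval, hom_eval₂]
    congr 1
    · ext a; simp
    · funext v
      simp
  have hq0 : q = 0 := by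
    refine MvPolynomial.funext_set (fun _ => Set.range ((↑) : ℤ → F))
      (fun _ => Set.infinite_range_of_injective Int.cast_injective) fun y hy => ?_
    choose z hz using fun v => hy v (Set.mem_univ v)
    rw [hq, map_zero, ← hp fun i => ∑ u ∈ (w i).support, z (i, u) • u]
    congr 1
    refine congrArg _ (funext fun v => ?_)
    rw [map_sum]
    refine Finset.sum_congr rfl fun u _ => ?_
    rw [map_zsmul, zsmul_eq_mul, hz]
  have hx := hq fun v => w v.1 v.2
  rw [hq0, map_zero] at hx
  rw [map_zero, hx]
  refine eval₂Hom_congr' rfl (fun v hv _ => ?_) rfl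
  exact (hw v.1 v.2 (Finset.mem_image_of_mem _ hv)).symm

end AdditiveMaps

/-! ### The generic closed matrix as a Jacobian matrix. -/

namespace DiffPoly

variable {m : ℕ} {ι : Type v} {F : Type u}

theorem iter_X [CommRing F] (Δ : CommutingDerivations m F) (α β : Fin m →₀ ℕ) (i : ι) :
    (derivations Δ).iter α (X (i, β) : DiffPoly m ι F) = X (i, β + α) := by
  induction α using CommutingDerivations.multiIndex_induction with
  | zero => simp
  | add_single α k ih =>
    rw [CommutingDerivations.iter_add_single_apply, ih]
    exact (deriv_X Δ k _).trans (by rw [add_assoc])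

/-- The substitution `x_{ij} ↦ ∂ᵢ y_j` of the generic Jacobian matrix. -/
noncomputable def jacobianSubst [CommRing F] :
    DiffPoly m (Fin m × Fin m) F →ₐ[F] DiffPoly m (Fin m) F :=
  aeval fun v => X (v.1.2, v.2 + Finsupp.single v.1.1 1)

theorem jacobianSubst_X [CommRing F] (v : (Fin m × Fin m) × (Fin m →₀ ℕ)) :
    jacobianSubst (X v : DiffPoly m (Fin m × Fin m) F)
      = X (v.1.2, v.2 + Finsupp.single v.1.1 1) :=
  aeval_X _ _

theorem jacobianSubst_C [CommRing F] (a : F) :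
    jacobianSubst (C a : DiffPoly m (Fin m × Fin m) F) = C a :=
  aeval_C _ _

theorem jacobianSubst_deriv [CommRing F] (Δ : CommutingDerivations m F) (k : Fin m)
    (p : DiffPoly m (Fin m × Fin m) F) :
    jacobianSubst (deriv Δ k p) = deriv Δ k (jacobianSubst p) := by
  induction p using MvPolynomial.induction_on with
  | C a => rw [deriv_C, jacobianSubst_C, jacobianSubst_C, deriv_C]
  | add p q hp hq => rw [map_add, map_add, map_add, map_add, hp, hq]
  | mul_X p v hp =>
    rw [Derivation.leibniz, map_mul, Derivation.leibniz, deriv_X, jacobianSubst_X, deriv_X]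
    simp only [smul_eq_mul, map_add, map_mul, jacobianSubst_X, hp]
    rw [add_right_comm]

variable [Field F] (Δ : CommutingDerivations m F)

theorem jacobianSubst_eq_zero_of_mem {p : DiffPoly m (Fin m × Fin m) F} (hp : p ∈ closedIdeal Δ) :
    jacobianSubst p = 0 := by
  have hle : closedIdeal Δ ≤ RingHom.ker (jacobianSubst (m := m) (F := F)) := by
    refine CommutingDerivations.diffSpan_le _ ?_ ?_
    · rintro _ ⟨i, j, k, rfl⟩
      change jacobianSubst (deriv Δ k _ - deriv Δ i _) = 0
      rw [map_sub, deriv_X, deriv_X, jacobianSubst_X, jacobianSubst_X, sub_eq_zero]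
      simp only [zero_add]
      rw [add_comm]
    · intro k x hx
      change jacobianSubst (deriv Δ k x) = 0
      rw [jacobianSubst_deriv, (RingHom.mem_ker).1 hx, map_zero]
  exact hle hp

/-- For `i ≠ i'`, write `α = γ + e_{i'}` and `α' = γ + e_i`; the difference is `∂^γ` of a basic
relation. -/
theorem mk_X_eq {i i' j : Fin m} {α α' : Fin m →₀ ℕ}
    (h : α + Finsupp.single i 1 = α' + Finsupp.single i' 1) :
    Ideal.Quotient.mk (closedIdeal Δ) (X ((i, j), α))
      = Ideal.Quotient.mk (closedIdeal Δ) (X ((i', j), α')) := by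
  by_cases hii : i = i'
  · subst hii
    rw [add_right_cancel h]
  obtain ⟨γ, rfl⟩ : ∃ γ, α = γ + Finsupp.single i' 1 := by
    refine ⟨α - Finsupp.single i' 1, (tsub_add_cancel_of_le ?_).symm⟩
    rw [Finsupp.single_le_iff]
    have := DFunLike.congr_fun h i'
    rw [Finsupp.add_apply, Finsupp.add_apply, Finsupp.single_eq_same,
      Finsupp.single_eq_of_ne (Ne.symm hii)] at this
    omega
  obtain rfl : γ + Finsupp.single i 1 = α' := by
    rw [add_right_comm] at h
    exact add_right_cancel h
  rw [Ideal.Quotient.eq]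
  have hmem := ((derivations Δ).isDiffIdeal_diffSpan _).iter_mem γ
    ((derivations Δ).subset_diffSpan _ ⟨i, j, i', rfl⟩ :
      (derivations Δ).d i' (X ((i, j), 0)) - (derivations Δ).d i (X ((i', j), 0)) ∈ closedIdeal Δ)
  change (derivations Δ).iter γ (deriv Δ i' _ - deriv Δ i _) ∈ closedIdeal Δ at hmem
  rw [map_sub, deriv_X, deriv_X, iter_X, iter_X, zero_add, zero_add, add_comm _ γ,
    add_comm _ γ] at hmem
  exact hmem

/-- The generic closed matrix is the Jacobian matrix of independent indeterminates: the kernel of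
`x_{ij} ↦ ∂ᵢ y_j` is the differential ideal of the basic relations. -/
theorem mem_closedIdeal_iff (p : DiffPoly m (Fin m × Fin m) F) :
    p ∈ closedIdeal Δ ↔ jacobianSubst p = 0 := by
  classical
  refine ⟨jacobianSubst_eq_zero_of_mem Δ, fun hp => ?_⟩
  -- A map with `ψ ∘ jacobianSubst` equal to the quotient map. By `mk_X_eq` the chosen index is
  -- immaterial; the value `0` at undifferentiated `y_j` is arbitrary, since these do not occur in
  -- the image.
  let ψ : DiffPoly m (Fin m) F →ₐ[F] GenericRing Δ := aeval fun w =>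
    if h : ∃ i, w.2 i ≠ 0 then
      Ideal.Quotient.mk (closedIdeal Δ) (X ((h.choose, w.1), w.2 - Finsupp.single h.choose 1))
    else 0
  have hψ : ψ.comp jacobianSubst = Ideal.Quotient.mkₐ F (closedIdeal Δ) := by
    refine MvPolynomial.algHom_ext fun v => ?_
    obtain ⟨⟨i, j⟩, α⟩ := v
    rw [AlgHom.comp_apply, jacobianSubst_X, Ideal.Quotient.mkₐ_eq_mk]
    have h : ∃ i', (α + Finsupp.single i 1 : Fin m →₀ ℕ) i' ≠ 0 := ⟨i, by simp⟩
    refine (aeval_X _ _).trans ((dif_pos h).trans (mk_X_eq Δ ?_))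
    refine tsub_add_cancel_of_le ?_
    rw [Finsupp.single_le_iff]
    exact Nat.one_le_iff_ne_zero.2 h.choose_spec
  rw [← Ideal.Quotient.eq_zero_iff_mem, ← Ideal.Quotient.mkₐ_eq_mk F, ← hψ, AlgHom.comp_apply, hp,
    map_zero]

theorem eval_jacobianSubst (a : Fin m → F) (p : DiffPoly m (Fin m × Fin m) F) :
    eval Δ a (jacobianSubst p) = eval Δ (fun ij => Δ.d ij.1 (a ij.2)) p := by
  have h : (aeval fun w : Fin m × (Fin m →₀ ℕ) => Δ.iter w.2 (a w.1)).comp jacobianSubst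
      = aeval (R := F) fun v : (Fin m × Fin m) × (Fin m →₀ ℕ) =>
        Δ.iter v.2 (Δ.d v.1.1 (a v.1.2)) := by
    refine MvPolynomial.algHom_ext fun v => ?_
    rw [AlgHom.comp_apply, jacobianSubst_X, aeval_X, aeval_X,
      CommutingDerivations.iter_d_apply]
  exact DFunLike.congr_fun h p

/-- Turns `p{T} = 0` into membership in the ideal. -/
theorem eval_genericMatrix (p : DiffPoly m (Fin m × Fin m) F) :
    eval (genericDerivations Δ) (fun ij => genericMatrix Δ ij.1 ij.2) p
      = Ideal.Quotient.mk (closedIdeal Δ) p := by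
  have h : (aeval fun v : (Fin m × Fin m) × (Fin m →₀ ℕ) =>
      (genericDerivations Δ).iter v.2 (genericMatrix Δ v.1.1 v.1.2))
        = Ideal.Quotient.mkₐ F (closedIdeal Δ) := by
    refine MvPolynomial.algHom_ext fun v => ?_
    obtain ⟨⟨i, j⟩, α⟩ := v
    rw [aeval_X, Ideal.Quotient.mkₐ_eq_mk]
    refine ((derivations Δ).map_iter (genericDerivations Δ) (Ideal.Quotient.mk (closedIdeal Δ))
      (fun k a => ((derivations Δ).quotientDerivation_mk _
        ((derivations Δ).isDiffIdeal_diffSpan _) k a).symm) α _).symm.trans ?_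
    rw [iter_X, zero_add]
  exact DFunLike.congr_fun h p

end DiffPoly

/-! ### The equivalence. -/

theorem proposition2p7 {m : ℕ} {F : Type u} [Field F] [CharZero F]
    (Δ : CommutingDerivations m F) :
    List.TFAE
      [LinearIndependent F Δ.d,
        ¬ ∃ (l : ℕ) (p : DiffPoly m (Fin l) F),
          p ≠ 0 ∧ ∀ a : Fin l → F, DiffPoly.eval Δ a p = 0,
        ∀ p : DiffPoly m (Fin m × Fin m) F,
          (∀ g ∈ GLd Δ, DiffPoly.eval Δ (fun ij => g.1 ij.1 ij.2) p = 0) →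
            DiffPoly.eval (genericDerivations Δ) (fun ij => genericMatrix Δ ij.1 ij.2) p = 0] := by
  classical
  tfae_have 1 → 2 := by
    rintro hΔ ⟨l, p, hp, h⟩
    exact hp (eq_zero_of_forall_eval_additive_eq_zero
      (fun α => (Δ.iter α : F →ₗ[ℤ] F).toAddMonoidHom) (Δ.eq_zero_of_sum_iter_eq_zero hΔ) p h)
  tfae_have 2 → 3 := by
    intro hb p hp
    rw [DiffPoly.eval_genericMatrix, Ideal.Quotient.eq_zero_iff_mem, DiffPoly.mem_closedIdeal_iff]
    let J : Matrix (Fin m) (Fin m) (DiffPoly m (Fin m) F) :=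
      Matrix.of fun i j => X (j, Finsupp.single i 1)
    have hJ : J.det ≠ 0 := by
      intro h0
      -- This point specializes `J` to the identity matrix.
      have h1 := congrArg (MvPolynomial.eval fun w : Fin m × (Fin m →₀ ℕ) =>
        if w.2 = Finsupp.single w.1 1 then (1 : F) else 0) h0
      rw [RingHom.map_det, map_zero] at h1
      refine one_ne_zero (α := F) ?_
      rw [← h1, ← Matrix.det_one (n := Fin m)]
      congr 1
      ext i j
      simp [J, Matrix.one_apply, Finsupp.single_left_inj]
    refine (mul_eq_zero.1 ?_).resolve_right hJ
    by_contra hne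
    refine hb ⟨m, _, hne, fun a => ?_⟩
    have hmul : DiffPoly.eval Δ a (DiffPoly.jacobianSubst p * J.det)
        = DiffPoly.eval Δ a (DiffPoly.jacobianSubst p)
          * (Matrix.of fun i j => Δ.d i (a j)).det := by
      unfold DiffPoly.eval
      rw [map_mul, AlgHom.map_det]
      congr 2
      ext i j
      simp [J]
    rw [hmul, DiffPoly.eval_jacobianSubst]
    -- An invertible Jacobian matrix lies in `GL^∂` because the derivations commute; otherwise the
    -- determinant factor vanishes.
    by_cases hdet : (Matrix.of fun i j => Δ.d i (a j)).det = 0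
    · rw [hdet, mul_zero]
    · have := hp (Matrix.GeneralLinearGroup.mkOfDetNeZero _ hdet)
        fun i j k => Δ.comm i j (a k)
      exact mul_eq_zero_of_left this _
  tfae_have 3 → 1 := by
    intro hc
    rw [Fintype.linearIndependent_iff]
    intro c hsum k
    let p : DiffPoly m (Fin m × Fin m) F := ∑ i, C (c i) * X ((k, k), Finsupp.single i 1)
    have hp : p ∈ closedIdeal Δ := by
      rw [← Ideal.Quotient.eq_zero_iff_mem, ← DiffPoly.eval_genericMatrix]
      refine hc p fun g _ => ?_
      have h := DFunLike.congr_fun hsum (g.1 k k)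
      rw [← Derivation.coeFnAddMonoidHom_apply, map_sum, Finset.sum_apply] at h
      simpa [DiffPoly.eval, p] using h
    rw [DiffPoly.mem_closedIdeal_iff] at hp
    -- The image of `p` is `∑ cᵢ ∂ᵢ ∂ₖ y_k`; this point isolates `c k`.
    have h := congrArg (MvPolynomial.eval fun w : Fin m × (Fin m →₀ ℕ) =>
      if w.2 = Finsupp.single k 1 + Finsupp.single k 1 then (1 : F) else 0) hp
    simpa [p, DiffPoly.jacobianSubst, Finsupp.single_left_inj] using h
  tfae_finish
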